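/- Let $b_1,b_2\in\mathbb{R}^2$ be linearly independent and equip $\mathbb{R}^2$ with the polytopic norm $\|a\|_{\mathcal P}=\max_{k=1,2}|a\cdot b_k|$. Let $G=(V,E)$ be a finite simple graph with at least one vertex and let $p=(p_v)_{v\in V}$ be a placement of its vertices in $\mathbb{R}^2$. An infinitesimal flex of $(G,p)$ is a $u=(u_v)_{v\in V}\in(\mathbb{R}^2)^V$ with $\|(p_v+tu_v)-(p_w+tu_w)\|_{\mathcal P}-\|p_v-p_w\|_{\mathcal P}=o(t)$ as $t\to0$ for every edge $vw\in E$. It is trivial if there is a family of continuous paths $\gamma_x:[-1,1]\to\mathbb{R}^2$ $(x\in\mathbb{R}^2)$, each differentiable at $0$ with $\gamma_x(0)=x$, such that $\|\gamma_x(t)-\gamma_y(t)\|_{\mathcal P}=\|x-y\|_{\mathcal P}$ for all $x,y\in\mathbb{R}^2$ and $t\in[-1,1]$, and $u_v=\gamma_{p_v}'(0)$ for all $v\in V$. The framework $(G,p)$ is infinitesimally rigid if all its infinitesimal flexes are trivial, and minimally infinitesimally rigid if moreover the removal of any single edge of $G$ gives a framework that is not infinitesimally rigid. For $a\in\mathbb{R}^2$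 let $\kappa(a)=b_k$ if $k$ is the unique index with $\|a\|_{\mathcal P}=|a\cdot b_k|$, and $\kappa(a)=0$ if there is no unique such index. The rigidity matrix $R_{\mathcal P}(G,p)$ is the $|E|\times 2|V|$ matrix whose row for an edge $vw$ has $\kappa(p_v-p_w)$ in the two columns of $v$, $-\kappa(p_v-p_w)$ in the two columns of $w$, and zeros elsewhere. Suppose that $(G,p)$ is * well-positioned: for every edge $vw\in E$ there is a unique index $k\in\{1,2\}$, the framework colour of $vw$, with $\|p_v-p_w\|_{\mathcal P}=|(p_v-p_w)\cdot b_k|$; and * regular: $\operatorname{rank}R_{\mathcal P}(G,p)\ge\operatorname{rank}R_{\mathcal P}(G,p')$ for every placement $p'\in(\mathbb{R}^2)^V$. For $k=1,2$ let $G_k$ be the graph with vertex set $V$ whose edges are the edges of $G$ of framework colour $k$. Then the following are equivalent: 1. $(G,p)$ is minimally infinitesimally rigid in $(\mathbb{R}^2,\|\cdot\|_{\mathcal P})$. 2. $G_1$ and $G_2$ are edge-disjoint spanning trees of $G$. 3. $G$ is $(2,2)$-tight, that is, $|E|=2|V|-2$ and $|E(H)|\le 2|V(H)|-2$ for every subgraph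 $H$ of $G$ with at least one vertex. -/

import Mathlib

open Filter Topology Asymptotics

namespace PolytopicRigidity

noncomputable section

/-! ### Infinitesimal rigidity with respect to a norm `N` on `ℝ^d`

The norm is passed as a function `N`; since all norms on `ℝ^d` are equivalent, continuity and
differentiability of paths do not depend on it. -/

/-- `u` is an infinitesimal flex of `(G, p)`: every edge length of `(G, p + t u)` differs from that
of `(G, p)` by `o(t)` as `t → 0`. -/
def IsInfinitesimalFlex {V : Type*} {d : ℕ} (N : (Fin d → ℝ) → ℝ) (G : SimpleGraph V)
    (p u : V → Fin d → ℝ) : Prop :=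
  ∀ i j : V, G.Adj i j →
    (fun t : ℝ => N ((p i + t • u i) - (p j + t • u j)) - N (p i - p j)) =o[𝓝 0]
      (fun t : ℝ => t)

/-- A rigid motion of `(ℝ^d, N)`: a family of paths `γ x`, of which only the values on `[-1, 1]`
matter. -/
structure IsRigidMotion {d : ℕ} (N : (Fin d → ℝ) → ℝ) (γ : (Fin d → ℝ) → ℝ → (Fin d → ℝ)) :
    Prop where
  continuousOn : ∀ x, ContinuousOn (γ x) (Set.Icc (-1) 1)
  differentiableAt : ∀ x, DifferentiableAt ℝ (γ x) 0
  map_zero : ∀ x, γ x 0 = x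
  isometry : ∀ t ∈ Set.Icc (-1 : ℝ) 1, ∀ x y, N (γ x t - γ y t) = N (x - y)

/-- `u` is induced on the framework points by a rigid motion. -/
def IsTrivialFlex {V : Type*} {d : ℕ} (N : (Fin d → ℝ) → ℝ) (p u : V → Fin d → ℝ) : Prop :=
  ∃ γ : (Fin d → ℝ) → ℝ → (Fin d → ℝ), IsRigidMotion N γ ∧ ∀ i, u i = deriv (γ (p i)) 0

/-- Every infinitesimal flex is trivial. -/
def IsInfinitesimallyRigid {V : Type*} {d : ℕ} (N : (Fin d → ℝ) → ℝ) (G : SimpleGraph V)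
    (p : V → Fin d → ℝ) : Prop :=
  ∀ u : V → Fin d → ℝ, IsInfinitesimalFlex N G p u → IsTrivialFlex N p u

/-- Infinitesimally rigid, and removing any single edge destroys this. -/
def IsMinimallyInfinitesimallyRigid {V : Type*} {d : ℕ} (N : (Fin d → ℝ) → ℝ)
    (G : SimpleGraph V) (p : V → Fin d → ℝ) : Prop :=
  IsInfinitesimallyRigid N G p ∧
    ∀ e ∈ G.edgeSet, ¬ IsInfinitesimallyRigid N (G.deleteEdges {e}) p

/-! ### Polytopic norms -/

/-- The polytopic norm `‖a‖ = max_k |a · b_k|`. -/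
def polyNorm {d s : ℕ} (b : Fin s → Fin d → ℝ) (a : Fin d → ℝ) : ℝ :=
  ⨆ k, |a ⬝ᵥ b k|

/-- `k` is the unique index with `‖a‖ = |a · b_k|`. -/
def HasColour {d s : ℕ} (b : Fin s → Fin d → ℝ) (a : Fin d → ℝ) (k : Fin s) : Prop :=
  polyNorm b a = |a ⬝ᵥ b k| ∧ ∀ l, polyNorm b a = |a ⬝ᵥ b l| → l = k

open Classical in
/-- `κ(a) = b_k` if `k` is the unique index with `‖a‖ = |a · b_k|`, and `κ(a) = 0` if there is no
such unique index. -/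
def kappa {d s : ℕ} (b : Fin s → Fin d → ℝ) (a : Fin d → ℝ) : Fin d → ℝ :=
  if h : ∃ k, HasColour b a k then b h.choose else 0

open Classical in
/-- The rigidity matrix. The row of an edge `e = {i, j}` has `κ(p i - p j)` in the columns of `i`,
`-κ(p i - p j)` in the columns of `j`, and zeros elsewhere, where `(i, j)` is a chosen ordering of
the end points of `e`. The choice affects the row only by a sign. -/
def rigidityMatrix {V : Type*} {d s : ℕ} (b : Fin s → Fin d → ℝ) (G : SimpleGraph V)
    (p : V → Fin d → ℝ) : Matrix G.edgeSet (V × Fin d) ℝ :=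
  fun e x =>
    let i : V := (Quot.out e.1).1
    let j : V := (Quot.out e.1).2
    if x.1 = i then kappa b (p i - p j) x.2
    else if x.1 = j then -kappa b (p i - p j) x.2
    else 0

/-- The rank of the rigidity matrix is maximal over all realisations of `G`. -/
def IsRegular {V : Type*} [Fintype V] {d s : ℕ} (b : Fin s → Fin d → ℝ) (G : SimpleGraph V)
    (p : V → Fin d → ℝ) : Prop :=
  ∀ p' : V → Fin d → ℝ, (rigidityMatrix b G p').rank ≤ (rigidityMatrix b G p).rank

/-- Every edge has a framework colour. -/
def IsWellPositioned {V : Type*} {d s : ℕ} (b : Fin s → Fin d → ℝ) (G : SimpleGraph V)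
    (p : V → Fin d → ℝ) : Prop :=
  ∀ i j : V, G.Adj i j → ∃ k, HasColour b (p i - p j) k

theorem hasColour_sub_comm {d s : ℕ} (b : Fin s → Fin d → ℝ) (x y : Fin d → ℝ) (k : Fin s) :
    HasColour b (x - y) k ↔ HasColour b (y - x) k := by
  have h : ∀ l, |(x - y) ⬝ᵥ b l| = |(y - x) ⬝ᵥ b l| := fun l => by
    rw [← neg_sub, neg_dotProduct, abs_neg]
  simp only [HasColour, polyNorm, h]

/-- The monochrome subgraph `G_k`: all vertices, and the edges of framework colour `k`. -/
def monochrome {V : Type*} {d s : ℕ} (b : Fin s → Fin d → ℝ) (G : SimpleGraph V)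
    (p : V → Fin d → ℝ) (k : Fin s) : SimpleGraph V where
  Adj i j := G.Adj i j ∧ HasColour b (p i - p j) k
  symm := ⟨fun _ _ h => ⟨h.1.symm, (hasColour_sub_comm b _ _ k).1 h.2⟩⟩
  loopless := ⟨fun _ h => h.1.ne rfl⟩

/-! ### Sparsity -/

/-- `|E(H)| ≤ 2|V(H)| - 2` for every subgraph `H` with at least one vertex. -/
def IsTwoTwoSparse {V : Type*} (G : SimpleGraph V) : Prop :=
  ∀ H : G.Subgraph, H.verts.Nonempty →
    (H.edgeSet.ncard : ℤ) ≤ 2 * (H.verts.ncard : ℤ) - 2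

/-- `(2,2)`-sparse with `|E| = 2|V| - 2`. -/
def IsTwoTwoTight {V : Type*} (G : SimpleGraph V) : Prop :=
  IsTwoTwoSparse G ∧ (G.edgeSet.ncard : ℤ) = 2 * (Nat.card V : ℤ) - 2

end

end PolytopicRigidity

/-!
An edge of colour `k` constrains an infinitesimal flex only through the `b k`-components of its end
points. Hence the kernel of the rigidity matrix splits into one part for each colour, and it
contains nothing but translations exactly when every colour class is connected. So a single
placement with connected colour classes makes the rank of every regular placement large enough for
connected colour classes, and counting edges turns these into trees.

For a (2,2)-tight graph such a placement is built by induction. Let `T` be a maximal proper tight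
vertex set with at least two vertices. If a vertex outside `T` has two neighbours in `T`, then
maximality forces it to be the only vertex outside `T`, and it can be placed so that its two edges
get different colours. Otherwise contract `T`, and shrink a placement of `T` into a small
neighbourhood of the contracted vertex. If there is no such `T`, then some vertex has degree three.
Either it spans a complete graph `K₄` with its neighbours, or it can be traded for an edge between
two of them.
-/

namespace PolytopicRigidity

/-! ### Framework colours -/

section Colour

variable {d s : ℕ} {b : Fin s → Fin d → ℝ} {a : Fin d → ℝ} {k l : Fin s}

theorem abs_dotProduct_le_polyNorm (b : Fin s → Fin d → ℝ) (a : Fin d → ℝ) (k : Fin s) :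
    |a ⬝ᵥ b k| ≤ polyNorm b a :=
  le_ciSup (f := fun k => |a ⬝ᵥ b k|) (Set.finite_range _).bddAbove k

theorem hasColour_iff : HasColour b a k ↔ ∀ l, l ≠ k → |a ⬝ᵥ b l| < |a ⬝ᵥ b k| := by
  refine ⟨fun h l hl => ?_, fun h => ?_⟩
  · rw [← h.1]
    exact (abs_dotProduct_le_polyNorm b a l).lt_of_ne fun e => hl (h.2 l e.symm)
  · have hk : polyNorm b a = |a ⬝ᵥ b k| := by
      have : Nonempty (Fin s) := ⟨k⟩
      refine (ciSup_le fun l => ?_).antisymm (abs_dotProduct_le_polyNorm b a k)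
      obtain rfl | hl := eq_or_ne l k
      exacts [le_rfl, (h l hl).le]
    exact ⟨hk, fun l hl => by_contra fun hne => (h l hne).ne (hl.symm.trans hk)⟩

theorem HasColour.unique (hk : HasColour b a k) (hl : HasColour b a l) : l = k :=
  hk.2 l hl.1

theorem kappa_eq (h : HasColour b a k) : kappa b a = b k := by
  have hex : ∃ k, HasColour b a k := ⟨k, h⟩
  rw [kappa, dif_pos hex, h.unique hex.choose_spec]

theorem kappa_eq_zero (h : ¬ ∃ k, HasColour b a k) : kappa b a = 0 :=
  dif_neg h

theorem HasColour.smul (h : HasColour b a k) {c : ℝ} (hc : c ≠ 0) : HasColour b (c • a) k := by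
  rw [hasColour_iff] at h ⊢
  intro l hl
  simp only [smul_dotProduct, smul_eq_mul, abs_mul]
  exact mul_lt_mul_of_pos_left (h l hl) (abs_pos.2 hc)

theorem isOpen_setOf_hasColour (b : Fin s → Fin d → ℝ) (k : Fin s) :
    IsOpen {a | HasColour b a k} := by
  simp only [hasColour_iff, Set.ofPred_forall]
  refine isOpen_iInter_of_finite fun l => isOpen_iInter_of_finite fun _ => ?_
  exact isOpen_lt (by fun_prop) (by fun_prop)

theorem HasColour.eventually {X : Type*} [TopologicalSpace X] {c : X → Fin d → ℝ} {x : X}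
    (h : HasColour b (c x) k) (hc : ContinuousAt c x) : ∀ᶠ y in 𝓝 x, HasColour b (c y) k :=
  hc ((isOpen_setOf_hasColour b k).mem_nhds h)

theorem HasColour.dotProduct_ne_zero [Nontrivial (Fin s)] (h : HasColour b a k) :
    a ⬝ᵥ b k ≠ 0 := by
  obtain ⟨l, hl⟩ := exists_ne k
  exact abs_pos.1 ((abs_nonneg _).trans_lt (hasColour_iff.1 h l hl))

theorem hasDerivAt_dotProduct {c : ℝ → Fin d → ℝ} {c' : Fin d → ℝ} {t : ℝ}
    (h : HasDerivAt c c' t) (w : Fin d → ℝ) :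
    HasDerivAt (fun t => c t ⬝ᵥ w) (c' ⬝ᵥ w) t :=
  HasDerivAt.fun_sum fun i _ => (hasDerivAt_pi.1 h i).mul_const (w i)

theorem hasDerivAt_add_smul (x w : Fin d → ℝ) :
    HasDerivAt (fun t : ℝ => x + t • w) w 0 := by
  simpa using ((hasDerivAt_id (0 : ℝ)).smul_const w).const_add x

variable [Nontrivial (Fin s)] {c : ℝ → Fin d → ℝ} {c' w : Fin d → ℝ}

theorem HasColour.hasDerivAt_polyNorm (h : HasColour b (c 0) k) (hc : HasDerivAt c c' 0) :
    HasDerivAt (fun t => polyNorm b (c t)) (SignType.sign (c 0 ⬝ᵥ b k) * (c' ⬝ᵥ b k)) 0 := by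
  refine ((hasDerivAt_abs h.dotProduct_ne_zero).comp 0
    (hasDerivAt_dotProduct hc (b k))).congr_of_eventuallyEq ?_
  filter_upwards [h.eventually hc.continuousAt] with t ht using ht.1

theorem HasColour.isLittleO_iff (h : HasColour b (c 0) k) (hc : HasDerivAt c c' 0) :
    ((fun t => polyNorm b (c t) - polyNorm b (c 0)) =o[𝓝 0] fun t : ℝ => t) ↔
      c' ⬝ᵥ b k = 0 := by
  have hsign : (SignType.sign (c 0 ⬝ᵥ b k) : ℝ) ≠ 0 :=
    (map_ne_zero (SignType.castHom (α := ℝ))).2 (sign_ne_zero.2 h.dotProduct_ne_zero)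
  have hderiv := h.hasDerivAt_polyNorm hc
  have hzero : ((fun t => polyNorm b (c t) - polyNorm b (c 0)) =o[𝓝 0] fun t : ℝ => t) ↔
      HasDerivAt (fun t => polyNorm b (c t)) 0 0 := by
    simp [hasDerivAt_iff_isLittleO]
  rw [hzero]
  refine ⟨fun h0 => (mul_eq_zero.1 (hderiv.unique h0)).resolve_left hsign, fun h0 => ?_⟩
  rwa [h0, mul_zero] at hderiv

end Colour

/-! ### Coordinates given by a basis of functionals -/

section Coordinates

variable {d : ℕ} {b : Fin d → Fin d → ℝ}

theorem exists_dotProduct_eq (hb : LinearIndependent ℝ b) (c : Fin d → ℝ) :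
    ∃ a : Fin d → ℝ, ∀ k, a ⬝ᵥ b k = c k := by
  obtain ⟨a, ha⟩ := Matrix.mulVec_surjective_iff_isUnit.2
    (Matrix.linearIndependent_rows_iff_isUnit (A := Matrix.of b).1 hb) c
  exact ⟨a, fun k => by rw [dotProduct_comm, ← ha]; rfl⟩

theorem eq_of_forall_dotProduct_eq (hb : LinearIndependent ℝ b) {x y : Fin d → ℝ}
    (h : ∀ k, x ⬝ᵥ b k = y ⬝ᵥ b k) : x = y := by
  refine Matrix.mulVec_injective_iff_isUnit.2
    (Matrix.linearIndependent_rows_iff_isUnit (A := Matrix.of b).1 hb) (funext fun k => ?_)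
  simpa only [Matrix.mulVec, Matrix.of_apply, dotProduct_comm _ (b k)] using h k

theorem exists_hasColour (hb : LinearIndependent ℝ b) (k : Fin d) : ∃ a, HasColour b a k := by
  obtain ⟨a, ha⟩ := exists_dotProduct_eq hb (Pi.single k 1)
  refine ⟨a, hasColour_iff.2 fun l hl => ?_⟩
  simp [ha, hl]

theorem exists_hasColour_sub_and_sub (hb : LinearIndependent ℝ b) (x y : Fin d → ℝ)
    (k : Fin d) : ∃ z, HasColour b (z - x) k ∧ HasColour b (z - y) k := by
  obtain ⟨e, he⟩ := exists_hasColour hb k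
  -- Seen from far away in the direction `e`, both points look like the origin.
  have hnear : ∀ w : Fin d → ℝ, ∀ᶠ t : ℝ in 𝓝[≠] 0, HasColour b (e - t • w) k := fun w =>
    nhdsWithin_le_nhds ((by simpa using he : HasColour b (e - (0 : ℝ) • w) k).eventually
      (c := fun t : ℝ => e - t • w) (by fun_prop))
  obtain ⟨t, ⟨hx, hy⟩, ht⟩ :=
    (((hnear x).and (hnear y)).and self_mem_nhdsWithin).exists
  have hscale : ∀ w : Fin d → ℝ, t⁻¹ • e - w = t⁻¹ • (e - t • w) := fun w => by
    rw [smul_sub, inv_smul_smul₀ ht]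
  exact ⟨t⁻¹ • e, hscale x ▸ hx.smul (inv_ne_zero ht), hscale y ▸ hy.smul (inv_ne_zero ht)⟩

/-- Increasing a coordinate of maximal absolute value away from zero gives a colour. -/
theorem dense_setOf_exists_hasColour [Nonempty (Fin d)] (hb : LinearIndependent ℝ b) :
    Dense {a | ∃ k, HasColour b a k} := by
  intro a
  obtain ⟨k, hk⟩ := Finite.exists_max fun k => |a ⬝ᵥ b k|
  obtain ⟨e, he⟩ := exists_dotProduct_eq hb (Pi.single k (if 0 ≤ a ⬝ᵥ b k then 1 else -1))
  have hlim : Tendsto (fun t : ℝ => a + t • e) (𝓝[>] 0) (𝓝 a) :=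
    tendsto_nhdsWithin_of_tendsto_nhds (Continuous.tendsto' (by fun_prop) _ _ (by simp))
  refine mem_closure_of_tendsto hlim ?_
  filter_upwards [self_mem_nhdsWithin] with t (ht : 0 < t)
  refine ⟨k, hasColour_iff.2 fun l hl => ?_⟩
  have hkl := hk l
  simp only [add_dotProduct, smul_dotProduct, he, Pi.single_eq_same, Pi.single_eq_of_ne hl,
    smul_eq_mul, mul_zero, add_zero]
  refine hkl.trans_lt ?_
  split_ifs with h0
  · rw [abs_of_nonneg h0, abs_of_nonneg (by linarith)]
    linarith
  · rw [abs_of_neg (by linarith), abs_of_neg (by linarith)]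
    linarith

end Coordinates

section Preconnected

variable {V : Type*} {K : SimpleGraph V}

theorem preconnected_iff_forall_const :
    K.Preconnected ↔ ∀ f : V → ℝ, (∀ x y, K.Adj x y → f x = f y) → ∀ x y, f x = f y := by
  refine ⟨fun hK f hf x y => ?_, fun h x y => ?_⟩
  · obtain ⟨w⟩ := hK x y
    induction w with
    | nil => rfl
    | cons hadj _ ih => exact (hf _ _ hadj).trans ih
  · classical
    have hxy := h (fun z => if K.Reachable x z then 1 else 0) (fun z z' hz =>
      if_congr ⟨fun r => r.trans hz.reachable, fun r => r.trans hz.symm.reachable⟩ rfl rfl) x y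
    by_contra hnot
    simp [hnot] at hxy

theorem preconnected_induce_iff_forall_const {S : Set V} :
    (K.induce S).Preconnected ↔ ∀ f : V → ℝ,
      (∀ x ∈ S, ∀ y ∈ S, K.Adj x y → f x = f y) → ∀ x ∈ S, ∀ y ∈ S, f x = f y := by
  rw [preconnected_iff_forall_const]
  refine ⟨fun h f hf x hx y hy => ?_, fun h f hf x y => ?_⟩
  · exact h (fun z => f z) (fun z z' hz => hf z z.2 z' z'.2 hz) ⟨x, hx⟩ ⟨y, hy⟩
  · have hext : ∀ z : S, Function.extend Subtype.val f 0 z = f z :=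
      Subtype.val_injective.extend_apply f 0
    have hxy := h (Function.extend Subtype.val f 0) (fun z hz z' hz' hadj => by
      simpa only [← hext] using hf ⟨z, hz⟩ ⟨z', hz'⟩ hadj) x x.2 y y.2
    rwa [hext, hext] at hxy

end Preconnected

/-! ### Infinitesimal rigidity -/

section Rigidity

variable {V : Type*} {d s : ℕ}

/-- The edge conditions of an infinitesimal flex of a well-positioned framework: the two end points
of an edge of colour `k` have velocities with equal `k`-th coordinate. -/
def IsMonochromeFlex (b : Fin s → Fin d → ℝ) (G : SimpleGraph V) (p u : V → Fin d → ℝ) : Prop :=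
  ∀ k i j, (monochrome b G p k).Adj i j → u i ⬝ᵥ b k = u j ⬝ᵥ b k

theorem isInfinitesimalFlex_iff [Nontrivial (Fin s)] {b : Fin s → Fin d → ℝ}
    {G : SimpleGraph V} {p u : V → Fin d → ℝ} (hwp : IsWellPositioned b G p) :
    IsInfinitesimalFlex (polyNorm b) G p u ↔ IsMonochromeFlex b G p u := by
  have hedge : ∀ {i j k}, HasColour b (p i - p j) k →
      (((fun t : ℝ => polyNorm b ((p i + t • u i) - (p j + t • u j)) - polyNorm b (p i - p j))
        =o[𝓝 0] fun t : ℝ => t) ↔ u i ⬝ᵥ b k = u j ⬝ᵥ b k) := fun {i j k} hk => by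
    have hderiv := (hasDerivAt_add_smul (p i) (u i)).sub (hasDerivAt_add_smul (p j) (u j))
    have hiff := HasColour.isLittleO_iff (b := b) (k := k) (by simpa using hk) hderiv
    simpa [sub_dotProduct, sub_eq_zero] using hiff
  refine ⟨fun h k i j hij => (hedge hij.2).1 (h i j hij.1), fun h i j hij => ?_⟩
  obtain ⟨k, hk⟩ := hwp i j hij
  exact (hedge hk).2 (h k i j ⟨hij, hk⟩)

theorem IsRigidMotion.deriv_dotProduct_eq {b : Fin s → Fin d → ℝ} [Nontrivial (Fin s)]
    {γ : (Fin d → ℝ) → ℝ → (Fin d → ℝ)} (hγ : IsRigidMotion (polyNorm b) γ) {x y : Fin d → ℝ}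
    {k : Fin s} (h : HasColour b (x - y) k) :
    deriv (γ x) 0 ⬝ᵥ b k = deriv (γ y) 0 ⬝ᵥ b k := by
  have hderiv := (hγ.differentiableAt x).hasDerivAt.sub (hγ.differentiableAt y).hasDerivAt
  rw [← sub_eq_zero, ← sub_dotProduct]
  refine (HasColour.isLittleO_iff (by simpa [hγ.map_zero] using h) hderiv).1 ?_
  refine (isLittleO_zero _ _).congr' ?_ EventuallyEq.rfl
  filter_upwards [Icc_mem_nhds (neg_lt_zero.2 one_pos) one_pos] with t ht
  simp only [Pi.sub_apply, hγ.map_zero, hγ.isometry t ht, sub_self]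

theorem monochrome_deleteEdges (b : Fin s → Fin d → ℝ) (G : SimpleGraph V) (p : V → Fin d → ℝ)
    (E : Set (Sym2 V)) (k : Fin s) :
    monochrome b (G.deleteEdges E) p k = (monochrome b G p k).deleteEdges E := by
  ext i j
  simp only [monochrome, SimpleGraph.deleteEdges_adj, and_right_comm]

theorem IsWellPositioned.mono {b : Fin s → Fin d → ℝ} {G G' : SimpleGraph V} {p : V → Fin d → ℝ}
    (hwp : IsWellPositioned b G p) (h : G' ≤ G) : IsWellPositioned b G' p :=
  fun i j hij => hwp i j (h hij)

theorem disjoint_edgeSet_monochrome (b : Fin s → Fin d → ℝ) (G : SimpleGraph V)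
    (p : V → Fin d → ℝ) {k l : Fin s} (hkl : k ≠ l) :
    Disjoint (monochrome b G p k).edgeSet (monochrome b G p l).edgeSet := by
  rw [SimpleGraph.disjoint_edgeSet, disjoint_iff_inf_le]
  exact fun i j hij => hkl (hij.2.2.unique hij.1.2)

variable {b : Fin d → Fin d → ℝ} {G : SimpleGraph V} {p u : V → Fin d → ℝ}

theorem forall_connected_monochrome_iff [Nonempty V] (hb : LinearIndependent ℝ b) :
    (∀ k, (monochrome b G p k).Connected) ↔
      ∀ u, IsMonochromeFlex b G p u → ∀ i j, u i = u j := by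
  simp only [SimpleGraph.connected_iff, ‹Nonempty V›, and_true, preconnected_iff_forall_const]
  refine ⟨fun h u hu i j => eq_of_forall_dotProduct_eq hb fun k =>
    h k (fun i => u i ⬝ᵥ b k) (hu k) i j, fun h k f hf x y => ?_⟩
  -- A function that is constant along the edges of colour `k` is a flex in the `k`-th coordinate.
  choose u hu using fun i => exists_dotProduct_eq hb (Pi.single k (f i))
  have hflex : IsMonochromeFlex b G p u := fun l i j hij => by
    obtain rfl | hl := eq_or_ne l k
    · simp only [hu, Pi.single_eq_same, hf i j hij]
    · simp only [hu, Pi.single_eq_of_ne hl]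
  simpa only [hu, Pi.single_eq_same] using congrArg (· ⬝ᵥ b k) (h u hflex x y)

variable [Nontrivial (Fin d)]

theorem IsRigidMotion.deriv_eq (hb : LinearIndependent ℝ b)
    {γ : (Fin d → ℝ) → ℝ → (Fin d → ℝ)} (hγ : IsRigidMotion (polyNorm b) γ) (x y : Fin d → ℝ) :
    deriv (γ x) 0 = deriv (γ y) 0 :=
  eq_of_forall_dotProduct_eq hb fun k =>
    have ⟨_, hx, hy⟩ := exists_hasColour_sub_and_sub hb x y k
    (hγ.deriv_dotProduct_eq hx).symm.trans (hγ.deriv_dotProduct_eq hy)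

theorem isTrivialFlex_iff [Nonempty V] (hb : LinearIndependent ℝ b) :
    IsTrivialFlex (polyNorm b) p u ↔ ∀ i j, u i = u j := by
  constructor
  · rintro ⟨γ, hγ, hu⟩ i j
    rw [hu, hu, hγ.deriv_eq hb]
  · intro h
    obtain ⟨v⟩ := ‹Nonempty V›
    refine ⟨fun x t => x + t • u v,
      ⟨fun x => by fun_prop, fun x => (hasDerivAt_add_smul x _).differentiableAt,
        fun x => by simp, fun t _ x y => by rw [add_sub_add_right_eq_sub]⟩, fun i => ?_⟩
    rw [h i v, (hasDerivAt_add_smul (p i) (u v)).deriv]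

theorem isInfinitesimallyRigid_iff [Nonempty V] (hb : LinearIndependent ℝ b)
    (hwp : IsWellPositioned b G p) :
    IsInfinitesimallyRigid (polyNorm b) G p ↔ ∀ k, (monochrome b G p k).Connected := by
  simp only [IsInfinitesimallyRigid, isTrivialFlex_iff hb, isInfinitesimalFlex_iff hwp,
    forall_connected_monochrome_iff hb]

theorem isMinimallyInfinitesimallyRigid_iff [Nonempty V] (hb : LinearIndependent ℝ b)
    (hwp : IsWellPositioned b G p) :
    IsMinimallyInfinitesimallyRigid (polyNorm b) G p ↔ ∀ k, (monochrome b G p k).IsTree := by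
  have hdel : ∀ e, IsInfinitesimallyRigid (polyNorm b) (G.deleteEdges {e}) p ↔
      ∀ k, ((monochrome b G p k).deleteEdges {e}).Connected := fun e => by
    simp only [isInfinitesimallyRigid_iff hb (hwp.mono (G.deleteEdges_le _)),
      monochrome_deleteEdges]
  simp only [IsMinimallyInfinitesimallyRigid, isInfinitesimallyRigid_iff hb hwp, hdel]
  constructor
  · rintro ⟨hconn, hmin⟩ k
    refine ⟨hconn k, SimpleGraph.isAcyclic_iff_forall_adj_isBridge.2 fun i j hij => ?_⟩
    by_contra hbr
    refine hmin s(i, j) hij.1 fun l => ?_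
    obtain rfl | hl := eq_or_ne l k
    · exact (hconn l).connected_delete_edge_of_not_isBridge hbr
    · rw [SimpleGraph.deleteEdges_eq_self.2 (Set.disjoint_singleton_right.2 fun h =>
        Set.disjoint_left.1 (disjoint_edgeSet_monochrome b G p hl) h hij)]
      exact hconn l
  · intro h
    refine ⟨fun k => (h k).connected, Sym2.ind fun i j hadj hconn => ?_⟩
    obtain ⟨k, hk⟩ := hwp i j hadj
    have hle := (SimpleGraph.isTree_iff_minimal_connected.1 (h k)).le_of_le (hconn k)
      (SimpleGraph.deleteEdges_le _)
    have hij : (monochrome b G p k).Adj i j := ⟨hadj, hk⟩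
    simpa using hle hij

end Rigidity

/-! ### The kernel of the rigidity matrix -/

section RigidityMatrix

variable {V : Type*} [Fintype V] {d : ℕ} {G : SimpleGraph V}

theorem rigidityMatrix_mulVec {s : ℕ} (b : Fin s → Fin d → ℝ) (p : V → Fin d → ℝ)
    (u : V × Fin d → ℝ) (e : G.edgeSet) :
    (rigidityMatrix b G p).mulVec u e =
      kappa b (p (Quot.out e.1).1 - p (Quot.out e.1).2) ⬝ᵥ
        (u.curry (Quot.out e.1).1 - u.curry (Quot.out e.1).2) := by
  classical
  have hne : (Quot.out e.1).1 ≠ (Quot.out e.1).2 := fun h =>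
    G.not_isDiag_of_mem_edgeSet e.2 (by
      rw [← Quot.out_eq e.1]
      exact h)
  simp only [rigidityMatrix, Matrix.mulVec, dotProduct, Pi.sub_apply, mul_sub,
    Finset.sum_sub_distrib, Function.curry]
  generalize (Quot.out e.1).1 = i at hne ⊢
  generalize (Quot.out e.1).2 = j at hne ⊢
  have hsplit : ∀ x : V × Fin d, (if x.1 = i then kappa b (p i - p j) x.2
      else if x.1 = j then -kappa b (p i - p j) x.2 else 0) * u x =
      (if x.1 = i then kappa b (p i - p j) x.2 * u x else 0) -
        if x.1 = j then kappa b (p i - p j) x.2 * u x else 0 := fun x => by grind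
  simp [hsplit, Fintype.sum_prod_type, Finset.sum_ite_irrel]

theorem mem_ker_rigidityMatrix_iff {s : ℕ} {b : Fin s → Fin d → ℝ} {p : V → Fin d → ℝ}
    {u : V × Fin d → ℝ} :
    u ∈ LinearMap.ker (rigidityMatrix b G p).mulVecLin ↔ IsMonochromeFlex b G p u.curry := by
  rw [LinearMap.mem_ker, Matrix.mulVecLin_apply, funext_iff]
  simp only [rigidityMatrix_mulVec, Pi.zero_apply]
  have hout : ∀ e : Sym2 V, s(e.out.1, e.out.2) = e := Quot.out_eq
  constructor
  · rintro h k i j ⟨hij, hk⟩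
    have hrow := h ⟨s(i, j), hij⟩
    obtain ⟨hi, hj⟩ | ⟨hi, hj⟩ := Sym2.eq_iff.1 (hout s(i, j))
    · rwa [hi, hj, kappa_eq hk, dotProduct_comm, sub_dotProduct, sub_eq_zero] at hrow
    · rw [hi, hj, kappa_eq ((hasColour_sub_comm b _ _ k).1 hk), dotProduct_comm,
        sub_dotProduct, sub_eq_zero] at hrow
      exact hrow.symm
  · intro h e
    by_cases hex : ∃ k, HasColour b (p e.1.out.1 - p e.1.out.2) k
    · obtain ⟨k, hk⟩ := hex
      have hadj : G.Adj e.1.out.1 e.1.out.2 := by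
        rw [← SimpleGraph.mem_edgeSet, hout]
        exact e.2
      rw [kappa_eq hk, dotProduct_comm, sub_dotProduct, sub_eq_zero]
      exact h k _ _ ⟨hadj, hk⟩
    · rw [kappa_eq_zero hex, zero_dotProduct]

theorem IsRegular.finrank_ker_le {s : ℕ} {b : Fin s → Fin d → ℝ} {p : V → Fin d → ℝ}
    (hreg : IsRegular b G p) (p' : V → Fin d → ℝ) :
    Module.finrank ℝ (LinearMap.ker (rigidityMatrix b G p).mulVecLin) ≤
      Module.finrank ℝ (LinearMap.ker (rigidityMatrix b G p').mulVecLin) := by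
  have h := (rigidityMatrix b G p).mulVecLin.finrank_range_add_finrank_ker
  have h' := (rigidityMatrix b G p').mulVecLin.finrank_range_add_finrank_ker
  have hrank := hreg p'
  unfold Matrix.rank at hrank
  lia

/-- The kernel of the rigidity matrix always contains the translations, so a regular placement has
no other flexes as soon as some placement has no others. -/
theorem IsRegular.connected_monochrome [Nonempty V] {b : Fin d → Fin d → ℝ}
    (hb : LinearIndependent ℝ b) {p p' : V → Fin d → ℝ} (hreg : IsRegular b G p)
    (hp' : ∀ k, (monochrome b G p' k).Connected) : ∀ k, (monochrome b G p k).Connected := by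
  rw [forall_connected_monochrome_iff hb] at hp' ⊢
  have hle : LinearMap.ker (rigidityMatrix b G p').mulVecLin ≤
      LinearMap.ker (rigidityMatrix b G p).mulVecLin := fun u hu => by
    rw [mem_ker_rigidityMatrix_iff] at hu ⊢
    exact fun k i j _ => congrArg (· ⬝ᵥ b k) (hp' _ hu i j)
  have hker := Submodule.eq_of_le_of_finrank_le hle (hreg.finrank_ker_le p')
  refine fun u hu => hp' u ?_
  have hmem : Function.uncurry u ∈ LinearMap.ker (rigidityMatrix b G p).mulVecLin :=
    mem_ker_rigidityMatrix_iff.2 hu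
  exact mem_ker_rigidityMatrix_iff.1 (hker.ge hmem)

end RigidityMatrix

/-! ### Edge counts -/

section EdgeCount

variable {V : Type*} [Finite V]

theorem ncard_edgeSet_add_one_le_of_isAcyclic [Nonempty V] {F : SimpleGraph V}
    (hF : F.IsAcyclic) : F.edgeSet.ncard + 1 ≤ Nat.card V := by
  obtain ⟨T, hFT, -, hT⟩ :=
    SimpleGraph.connected_top.exists_isTree_le_of_le_of_isAcyclic le_top hF
  rw [← (SimpleGraph.isTree_iff_connected_and_card.1 hT).2, Nat.card_coe_set_eq]
  gcongr
  exact Set.toFinite _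

theorem ncard_edgeSet_inter_add_one_le {G F : SimpleGraph V} (hF : F.IsAcyclic) (H : G.Subgraph)
    (hH : H.verts.Nonempty) : (H.edgeSet ∩ F.edgeSet).ncard + 1 ≤ H.verts.ncard := by
  have : Nonempty H.verts := hH.to_subtype
  have hsub : H.edgeSet ∩ F.edgeSet ⊆
      Sym2.map Subtype.val '' (H.coe ⊓ F.induce H.verts).edgeSet := by
    rintro ⟨x, y⟩ ⟨hxy, hF⟩
    exact ⟨s(⟨x, H.edge_vert hxy⟩, ⟨y, H.edge_vert hxy.symm⟩), ⟨hxy, hF⟩, rfl⟩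
  calc (H.edgeSet ∩ F.edgeSet).ncard + 1
      ≤ (H.coe ⊓ F.induce H.verts).edgeSet.ncard + 1 := by
        gcongr
        exact (Set.ncard_le_ncard hsub).trans (Set.ncard_image_le (Set.toFinite _))
    _ ≤ Nat.card H.verts :=
        ncard_edgeSet_add_one_le_of_isAcyclic ((hF.induce H.verts).anti inf_le_right)

variable {d s : ℕ} {b : Fin s → Fin d → ℝ} {G : SimpleGraph V} {p : V → Fin d → ℝ}

theorem ncard_edgeSet_eq_sum (hwp : IsWellPositioned b G p) (H : G.Subgraph) :
    H.edgeSet.ncard = ∑ k, (H.edgeSet ∩ (monochrome b G p k).edgeSet).ncard := by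
  have hunion : H.edgeSet = ⋃ k, H.edgeSet ∩ (monochrome b G p k).edgeSet := by
    rw [← Set.inter_iUnion, eq_comm, Set.inter_eq_left]
    rintro ⟨i, j⟩ hij
    obtain ⟨k, hk⟩ := hwp i j (H.adj_sub hij)
    exact Set.mem_iUnion.2 ⟨k, H.adj_sub hij, hk⟩
  conv_lhs => rw [hunion]
  rw [Set.ncard_iUnion_of_finite (fun _ => Set.toFinite _), finsum_eq_sum_of_fintype]
  exact fun k l hkl => (disjoint_edgeSet_monochrome b G p hkl).mono
    Set.inter_subset_right Set.inter_subset_right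

theorem ncard_edgeSet_eq_sum_monochrome (hwp : IsWellPositioned b G p) :
    G.edgeSet.ncard = ∑ k, (monochrome b G p k).edgeSet.ncard := by
  have hle : ∀ k, (monochrome b G p k).edgeSet ⊆ G.edgeSet := fun k =>
    SimpleGraph.edgeSet_mono fun _ _ h => h.1
  simpa [Set.inter_eq_right.2 (hle _)] using ncard_edgeSet_eq_sum hwp ⊤

theorem ncard_edgeSet_add_le_of_isAcyclic (hwp : IsWellPositioned b G p)
    (h : ∀ k, (monochrome b G p k).IsAcyclic) (H : G.Subgraph) (hH : H.verts.Nonempty) :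
    H.edgeSet.ncard + s ≤ s * H.verts.ncard := by
  have hsum := Finset.sum_le_sum fun k (_ : k ∈ Finset.univ) =>
    ncard_edgeSet_inter_add_one_le (h k) H hH
  simpa [Finset.sum_add_distrib, ← ncard_edgeSet_eq_sum hwp H] using hsum

theorem ncard_edgeSet_add_eq_of_isTree (hwp : IsWellPositioned b G p)
    (h : ∀ k, (monochrome b G p k).IsTree) : G.edgeSet.ncard + s = s * Nat.card V := by
  have hsum := Finset.sum_congr rfl fun k (_ : k ∈ Finset.univ) =>
    (SimpleGraph.isTree_iff_connected_and_card.1 (h k)).2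
  simpa [Finset.sum_add_distrib, ← ncard_edgeSet_eq_sum_monochrome hwp] using hsum

theorem isTree_monochrome_of_connected (hwp : IsWellPositioned b G p)
    (hconn : ∀ k, (monochrome b G p k).Connected)
    (hcard : G.edgeSet.ncard + s = s * Nat.card V) (k : Fin s) :
    (monochrome b G p k).IsTree := by
  have hle : ∀ k ∈ Finset.univ, Nat.card V ≤ (monochrome b G p k).edgeSet.ncard + 1 :=
    fun k _ => (hconn k).card_vert_le_card_edgeSet_add_one
  have hsum : ∑ _k : Fin s, Nat.card V = ∑ k, ((monochrome b G p k).edgeSet.ncard + 1) := by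
    simp [Finset.sum_add_distrib, ← ncard_edgeSet_eq_sum_monochrome hwp, hcard]
  exact SimpleGraph.isTree_iff_connected_and_card.2
    ⟨hconn k, ((Finset.sum_eq_sum_iff_of_le hle).1 hsum k (Finset.mem_univ k)).symm⟩

theorem isTwoTwoTight_of_isTree {b : Fin 2 → Fin d → ℝ} (hwp : IsWellPositioned b G p)
    (h : ∀ k, (monochrome b G p k).IsTree) : IsTwoTwoTight G := by
  refine ⟨fun H hH => ?_, ?_⟩
  · have hcard := ncard_edgeSet_add_le_of_isAcyclic hwp (fun k => (h k).isAcyclic) H hH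
    lia
  · have hcard := ncard_edgeSet_add_eq_of_isTree hwp h
    lia

end EdgeCount

/-! ### Sparse and tight vertex sets -/

section Sparsity

open scoped Finset

variable {V : Type*} {G : SimpleGraph V} {S T X : Finset V} {u v a b h : V}

open Classical in
/-- The edges of `G` with both end points in `X`. -/
noncomputable def spannedEdges (G : SimpleGraph V) (X : Finset V) : Finset (Sym2 V) :=
  {e ∈ X.sym2 | e ∈ G.edgeSet}

open Classical in
/-- The neighbours of `v` in `X`. -/
noncomputable def neighborsIn (G : SimpleGraph V) (X : Finset V) (v : V) : Finset V :=
  {x ∈ X | G.Adj v x}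

/-- Every nonempty subset `X` of `S` spans at most `2|X| - 2` edges. -/
def IsSparseOn (G : SimpleGraph V) (S : Finset V) : Prop :=
  ∀ X ⊆ S, X.Nonempty → #(spannedEdges G X) + 2 ≤ 2 * #X

/-- `S` spans exactly `2|S| - 2` edges. -/
def IsTightOn (G : SimpleGraph V) (S : Finset V) : Prop :=
  #(spannedEdges G S) + 2 = 2 * #S

theorem mk_mem_spannedEdges : s(u, v) ∈ spannedEdges G X ↔ (u ∈ X ∧ v ∈ X) ∧ G.Adj u v := by
  simp [spannedEdges]

theorem mem_neighborsIn : u ∈ neighborsIn G X v ↔ u ∈ X ∧ G.Adj v u := by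
  simp [neighborsIn]

theorem neighborsIn_subset : neighborsIn G X v ⊆ X :=
  fun _ h => (mem_neighborsIn.1 h).1

theorem spannedEdges_singleton (G : SimpleGraph V) (v : V) : spannedEdges G {v} = ∅ := by
  ext ⟨x, y⟩
  simp only [mk_mem_spannedEdges, Finset.mem_singleton, Finset.notMem_empty, iff_false]
  rintro ⟨⟨rfl, rfl⟩, hadj⟩
  exact hadj.ne rfl

theorem IsSparseOn.mono (hS : IsSparseOn G S) (hTS : T ⊆ S) : IsSparseOn G T :=
  fun X hX => hS X (hX.trans hTS)

theorem coe_spannedEdges (G : SimpleGraph V) (X : Finset V) :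
    (spannedEdges G X : Set (Sym2 V)) = ((⊤ : G.Subgraph).induce X).edgeSet := by
  ext ⟨x, y⟩
  simp [mk_mem_spannedEdges, and_assoc]

theorem IsTwoTwoSparse.isSparseOn (hG : IsTwoTwoSparse G) : IsSparseOn G S := by
  intro X _ hX
  have hcard := hG ((⊤ : G.Subgraph).induce X) hX
  rw [← coe_spannedEdges, SimpleGraph.Subgraph.induce_verts, Set.ncard_coe_finset,
    Set.ncard_coe_finset] at hcard
  lia

theorem IsTwoTwoTight.isTightOn [Fintype V] (hG : IsTwoTwoTight G) :
    IsTightOn G Finset.univ := by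
  have hcoe : (spannedEdges G Finset.univ : Set (Sym2 V)) = G.edgeSet := by
    ext ⟨x, y⟩
    simp [mk_mem_spannedEdges]
  have hcard := hG.2
  rw [← hcoe, Set.ncard_coe_finset, Nat.card_eq_fintype_card] at hcard
  rw [IsTightOn, Finset.card_univ]
  lia

theorem IsSparseOn.sup_edge (hS : IsSparseOn G S) (hab : a ≠ b)
    (hnt : ∀ T ⊆ S, 2 ≤ #T → ¬ IsTightOn G T) : IsSparseOn (G ⊔ SimpleGraph.edge a b) S := by
  classical
  intro X hX hne
  have hcard := hS X hX hne
  by_cases hmem : a ∈ X ∧ b ∈ X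
  · have hsub : spannedEdges (G ⊔ SimpleGraph.edge a b) X ⊆
        insert s(a, b) (spannedEdges G X) := by
      rintro ⟨x, y⟩
      simp only [mk_mem_spannedEdges, SimpleGraph.sup_adj, SimpleGraph.edge_adj,
        Finset.mem_insert, Sym2.eq_iff]
      tauto
    have hle := (Finset.card_le_card hsub).trans (Finset.card_insert_le _ _)
    have hntX := hnt X hX (Finset.one_lt_card.2 ⟨a, hmem.1, b, hmem.2, hab⟩)
    rw [IsTightOn] at hntX
    lia
  · have heq : spannedEdges (G ⊔ SimpleGraph.edge a b) X = spannedEdges G X := by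
      ext ⟨x, y⟩
      simp only [mk_mem_spannedEdges, SimpleGraph.sup_adj, SimpleGraph.edge_adj]
      grind
    rwa [heq]

theorem card_spannedEdges_insert [DecidableEq V] (hv : v ∉ X) :
    #(spannedEdges G (insert v X)) = #(spannedEdges G X) + #(neighborsIn G X v) := by
  have hunion : spannedEdges G (insert v X) =
      spannedEdges G X ∪ (neighborsIn G X v).image (s(v, ·)) := by
    ext ⟨x, y⟩
    have hxy := G.ne_of_adj (a := x) (b := y)
    simp only [mk_mem_spannedEdges, Finset.mem_union, Finset.mem_image, mem_neighborsIn,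
      Finset.mem_insert, Sym2.eq_iff]
    grind [G.adj_comm x y]
  have hdisj : Disjoint (spannedEdges G X) ((neighborsIn G X v).image (s(v, ·))) := by
    simp only [Finset.disjoint_right, Finset.forall_mem_image, mk_mem_spannedEdges]
    exact fun x _ h => hv h.1.1
  rw [hunion, Finset.card_union_of_disjoint hdisj,
    Finset.card_image_of_injective _ fun x y => Sym2.congr_right.1]

theorem sum_card_neighborsIn (G : SimpleGraph V) (X : Finset V) :
    ∑ v ∈ X, #(neighborsIn G X v) = 2 * #(spannedEdges G X) := by
  classical
  induction X using Finset.induction_on with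
  | empty => simp [spannedEdges]
  | insert v X hv ih =>
    have hstep : ∀ x, #(neighborsIn G (insert v X) x) =
        #(neighborsIn G X x) + if G.Adj v x then 1 else 0 := fun x => by
      split_ifs with h
      · have heq : neighborsIn G (insert v X) x = insert v (neighborsIn G X x) := by
          ext y
          simp only [mem_neighborsIn, Finset.mem_insert]
          grind [G.adj_comm v x]
        rw [heq, Finset.card_insert_of_notMem fun h' => hv (mem_neighborsIn.1 h').1]
      · congr 1
        ext y
        simp only [mem_neighborsIn, Finset.mem_insert]
        grind [G.adj_comm v x]
    have hself : neighborsIn G (insert v X) v = neighborsIn G X v := by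
      ext y
      simp only [mem_neighborsIn, Finset.mem_insert]
      grind [G.ne_of_adj (a := v) (b := y)]
    have hfilter : neighborsIn G X v = {x ∈ X | G.Adj v x} := by
      ext y
      simp [mem_neighborsIn]
    rw [Finset.sum_insert hv, Finset.sum_congr rfl fun x _ => hstep x, Finset.sum_add_distrib, ih,
      hself, card_spannedEdges_insert hv, ← Finset.card_filter, ← hfilter]
    lia

theorem card_spannedEdges_of_isClique (hX : G.IsClique X) :
    #(spannedEdges G X) = (#X).choose 2 := by
  classical
  induction X using Finset.induction_on with
  | empty => simp [spannedEdges]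
  | insert v X hv ih =>
    rw [Finset.coe_insert, SimpleGraph.isClique_insert] at hX
    have hneighbors : neighborsIn G X v = X := neighborsIn_subset.antisymm fun x hx =>
      mem_neighborsIn.2 ⟨hx, hX.2 x hx (ne_of_mem_of_not_mem hx hv).symm⟩
    rw [card_spannedEdges_insert hv, Finset.card_insert_of_notMem hv, ih hX.1, hneighbors,
      Nat.choose_succ_succ' _ 1, Nat.choose_one_right, add_comm]

theorem isTightOn_of_isNClique (hX : G.IsNClique 4 X) : IsTightOn G X := by
  rw [IsTightOn, card_spannedEdges_of_isClique hX.isClique, hX.card_eq]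
  rfl

theorem IsSparseOn.card_neighborsIn_le_two (hS : IsSparseOn G S) (hTS : T ⊆ S)
    (hT : IsTightOn G T) (hv : v ∈ S) (hvT : v ∉ T) : #(neighborsIn G T v) ≤ 2 := by
  classical
  have hcard := hS (insert v T) (Finset.insert_subset hv hTS) (Finset.insert_nonempty v T)
  rw [card_spannedEdges_insert hvT, Finset.card_insert_of_notMem hvT] at hcard
  rw [IsTightOn] at hT
  lia

section DecidableEq

variable [DecidableEq V]

theorem card_spannedEdges_erase (hv : v ∈ X) :
    #(spannedEdges G X) =
      #(spannedEdges G (X.erase v)) + #(neighborsIn G (X.erase v) v) := by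
  rw [← card_spannedEdges_insert (Finset.notMem_erase v X), Finset.insert_erase hv]

theorem IsTightOn.insert_of_card_neighborsIn (hT : IsTightOn G T) (hv : v ∉ T)
    (h2 : #(neighborsIn G T v) = 2) : IsTightOn G (insert v T) := by
  rw [IsTightOn] at hT ⊢
  rw [card_spannedEdges_insert hv, Finset.card_insert_of_notMem hv]
  lia

theorem IsSparseOn.exists_card_neighborsIn_eq_three (hS : IsSparseOn G S) (hSt : IsTightOn G S)
    (hcard : 2 ≤ #S) (hmin : ∀ T ⊂ S, 2 ≤ #T → ¬ IsTightOn G T) :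
    ∃ v ∈ S, #(neighborsIn G (S.erase v) v) = 3 := by
  rw [IsTightOn] at hSt
  have hself : ∀ v, neighborsIn G S v = neighborsIn G (S.erase v) v := fun v => by
    ext x
    simpa [mem_neighborsIn] using fun h _ => (G.ne_of_adj h).symm
  obtain ⟨v, hv, hlt⟩ : ∃ v ∈ S, #(neighborsIn G S v) < 4 := Finset.exists_lt_of_sum_lt <| by
    rw [sum_card_neighborsIn, Finset.sum_const, smul_eq_mul]
    lia
  refine ⟨v, hv, ?_⟩
  rw [hself] at hlt
  have herase := Finset.card_erase_of_mem hv
  have hsparse := hS _ (S.erase_subset v) (Finset.card_pos.1 (by lia))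
  have hdecomp := card_spannedEdges_erase (G := G) hv
  have hle : #(neighborsIn G (S.erase v) v) ≤ #(S.erase v) :=
    Finset.card_le_card neighborsIn_subset
  have htight := hmin _ (Finset.erase_ssubset hv)
  rw [IsTightOn] at htight
  lia

theorem IsTightOn.erase_sup_edge (hS : IsTightOn G S) (hv : v ∈ S)
    (h3 : #(neighborsIn G (S.erase v) v) = 3) (ha : a ∈ S.erase v) (hb : b ∈ S.erase v)
    (hab : a ≠ b) (hadj : ¬ G.Adj a b) :
    IsTightOn (G ⊔ SimpleGraph.edge a b) (S.erase v) := by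
  have heq : spannedEdges (G ⊔ SimpleGraph.edge a b) (S.erase v) =
      insert s(a, b) (spannedEdges G (S.erase v)) := by
    ext ⟨x, y⟩
    simp only [mk_mem_spannedEdges, SimpleGraph.sup_adj, SimpleGraph.edge_adj,
      Finset.mem_insert, Sym2.eq_iff]
    grind
  have hnot : s(a, b) ∉ spannedEdges G (S.erase v) := fun h => hadj (mk_mem_spannedEdges.1 h).2
  have hdecomp := card_spannedEdges_erase (G := G) hv
  rw [IsTightOn] at hS ⊢
  rw [heq, Finset.card_insert_of_notMem hnot, Finset.card_erase_of_mem hv]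
  lia

/-- The map that sends all of `T` to `h`, so that `G.map (collapse T h)` is `G` with `T` contracted
to the vertex `h`. -/
def collapse (T : Finset V) (h v : V) : V := if v ∈ T then h else v

theorem collapse_of_mem (hv : v ∈ T) : collapse T h v = h := if_pos hv

theorem collapse_of_notMem (hv : v ∉ T) : collapse T h v = v := if_neg hv

theorem image_collapse (hh : h ∈ T) (hXT : Disjoint X T) :
    (X ∪ T).image (collapse T h) = insert h X := by
  ext x
  simp only [Finset.mem_image, Finset.mem_insert, Finset.mem_union]
  grind [collapse, Finset.disjoint_left]

theorem neighborsIn_map_collapse (hh : h ∈ T) (hXT : Disjoint X T) (hv : v ∉ T) :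
    neighborsIn (G.map (collapse T h)) (insert h X) v =
      (neighborsIn G (X ∪ T) v).image (collapse T h) := by
  ext y
  simp only [← image_collapse hh hXT, mem_neighborsIn, Finset.mem_image, SimpleGraph.map_adj',
    Finset.mem_union]
  have hirrefl : ¬ G.Adj v v := G.irrefl
  grind [collapse]

theorem card_spannedEdges_map_collapse (hh : h ∈ T) (hXT : Disjoint X T)
    (hdeg : ∀ v ∈ X, #(neighborsIn G T v) ≤ 1) :
    #(spannedEdges (G.map (collapse T h)) (insert h X)) + #(spannedEdges G T) =
      #(spannedEdges G (X ∪ T)) := by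
  induction X using Finset.induction_on with
  | empty => simp [spannedEdges_singleton]
  | insert v X hv ih =>
    rw [Finset.disjoint_insert_left] at hXT
    have hinj : Set.InjOn (collapse T h) (neighborsIn G (X ∪ T) v) := fun x hx y hy hxy => by
      have hone := Finset.card_le_one.1 (hdeg v (Finset.mem_insert_self v X)) x
      simp only [Finset.mem_coe, mem_neighborsIn, Finset.mem_union] at hx hy hone
      grind [collapse]
    have hneighbors : #(neighborsIn (G.map (collapse T h)) (insert h X) v) =
        #(neighborsIn G (X ∪ T) v) := by
      rw [neighborsIn_map_collapse hh hXT.2 hXT.1,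
        Finset.card_image_of_injOn hinj]
    rw [Finset.insert_comm, card_spannedEdges_insert (v := v) (by grind), Finset.insert_union,
      card_spannedEdges_insert (X := X ∪ T) (by grind), hneighbors,
      ← ih hXT.2 fun x hx => hdeg x (Finset.mem_insert_of_mem hx)]
    lia

theorem spannedEdges_map_collapse_subset (hhX : h ∉ X) :
    spannedEdges (G.map (collapse T h)) X ⊆ spannedEdges G X := by
  rintro ⟨x, y⟩
  simp only [mk_mem_spannedEdges, SimpleGraph.map_adj']
  grind [collapse]

theorem IsTightOn.map_collapse (hS : IsTightOn G S) (hT : IsTightOn G T) (hTS : T ⊆ S)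
    (hh : h ∈ T) (hdeg : ∀ v ∈ S \ T, #(neighborsIn G T v) ≤ 1) :
    IsTightOn (G.map (collapse T h)) (insert h (S \ T)) := by
  have hedges := card_spannedEdges_map_collapse hh Finset.sdiff_disjoint hdeg
  have hverts := Finset.card_sdiff_add_card_eq_card hTS
  rw [Finset.sdiff_union_of_subset hTS] at hedges
  rw [IsTightOn] at hS hT ⊢
  rw [Finset.card_insert_of_notMem (by simp [hh])]
  lia

theorem IsSparseOn.map_collapse (hS : IsSparseOn G S) (hT : IsTightOn G T) (hTS : T ⊆ S)
    (hh : h ∈ T) (hdeg : ∀ v ∈ S \ T, #(neighborsIn G T v) ≤ 1) :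
    IsSparseOn (G.map (collapse T h)) (insert h (S \ T)) := by
  intro X hX hne
  by_cases hhX : h ∈ X
  · have hsub : X.erase h ⊆ S \ T := Finset.subset_insert_iff.1 hX
    have hdisj : Disjoint (X.erase h) T := Finset.sdiff_disjoint.mono_left hsub
    have hedges := card_spannedEdges_map_collapse hh hdisj fun v hv => hdeg v (hsub hv)
    have hcard := hS (X.erase h ∪ T)
      (Finset.union_subset (hsub.trans Finset.sdiff_subset) hTS) ⟨h, by simp [hh]⟩
    have herase := Finset.card_erase_add_one hhX
    rw [Finset.insert_erase hhX] at hedges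
    rw [Finset.card_union_of_disjoint hdisj] at hcard
    rw [IsTightOn] at hT
    lia
  · have hsub : X ⊆ S \ T := (Finset.subset_insert_iff_of_notMem hhX).1 hX
    have hle := Finset.card_le_card (spannedEdges_map_collapse_subset (G := G) (T := T) hhX)
    have hcard := hS X (hsub.trans Finset.sdiff_subset) hne
    lia

end DecidableEq

end Sparsity

/-! ### Choosing the position of a vertex -/

section Position

variable {d : ℕ} {k l : Fin d}

theorem HasColour.ne {s : ℕ} [Nontrivial (Fin s)] {b : Fin s → Fin d → ℝ} {x y : Fin d → ℝ}
    {k : Fin s} (h : HasColour b (x - y) k) : x ≠ y := by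
  rintro rfl
  exact h.dotProduct_ne_zero (by simp)

theorem isOpen_setOf_hasColour_sub {s : ℕ} (b : Fin s → Fin d → ℝ) (x : Fin d → ℝ) (k : Fin s) :
    IsOpen {q | HasColour b (q - x) k} :=
  (isOpen_setOf_hasColour b k).preimage (by fun_prop)

theorem exists_mem_forall_hasColour_sub {ι : Type*} [Nonempty (Fin d)] {b : Fin d → Fin d → ℝ}
    (hb : LinearIndependent ℝ b) (S : Finset ι) (p : ι → Fin d → ℝ) {U : Set (Fin d → ℝ)}
    (hU : IsOpen U) (hne : U.Nonempty) : ∃ q ∈ U, ∀ x ∈ S, ∃ k, HasColour b (q - p x) k := by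
  have hopen : IsOpen {a | ∃ k, HasColour b a k} := by
    rw [Set.ofPred_exists]
    exact isOpen_iUnion fun k => isOpen_setOf_hasColour b k
  have hdense : Dense (⋂ x ∈ S, (· - p x) ⁻¹' {a | ∃ k, HasColour b a k}) :=
    dense_biInter_of_isOpen (fun x _ => hopen.preimage (by fun_prop)) S.countable_toSet
      fun x _ => (dense_setOf_exists_hasColour hb).preimage (isOpenMap_sub_right (p x))
  obtain ⟨q, hq, hqU⟩ := hdense.inter_open_nonempty U hU hne
  exact ⟨q, hq, fun x hx => Set.mem_iInter₂.1 hqU x hx⟩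

theorem frequently_hasColour_sub {b : Fin d → Fin d → ℝ} (hb : LinearIndependent ℝ b)
    (x : Fin d → ℝ) (k : Fin d) : ∃ᶠ q in 𝓝 x, HasColour b (q - x) k := by
  obtain ⟨e, he⟩ := exists_hasColour hb k
  have hlim : Tendsto (fun t : ℝ => x + t • e) (𝓝[≠] 0) (𝓝 x) :=
    tendsto_nhdsWithin_of_tendsto_nhds (Continuous.tendsto' (by fun_prop) _ _ (by simp))
  refine hlim.frequently (Eventually.frequently ?_)
  filter_upwards [self_mem_nhdsWithin] with t ht
  simpa using he.smul ht

theorem HasColour.exists_sub_and_sub {b : Fin d → Fin d → ℝ} (hb : LinearIndependent ℝ b)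
    {x y : Fin d → ℝ} (hxy : HasColour b (x - y) l) (k : Fin d) :
    ∃ q, HasColour b (q - x) k ∧ HasColour b (q - y) l :=
  ((frequently_hasColour_sub hb x k).and_eventually
    (hxy.eventually (c := (· - y)) (by fun_prop))).exists

theorem hasColour_of_dotProduct_eq_zero {b : Fin 2 → Fin 2 → ℝ} (hb : LinearIndependent ℝ b)
    {a : Fin 2 → ℝ} {k l : Fin 2} (hkl : k ≠ l) (ha : a ≠ 0) (hk : a ⬝ᵥ b k = 0) :
    HasColour b a l := by
  refine hasColour_iff.2 fun m hm => ?_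
  obtain rfl : m = k := by lia
  rw [hk, abs_zero, abs_pos]
  refine fun hl => ha (eq_of_forall_dotProduct_eq hb fun n => ?_)
  obtain rfl | rfl : n = m ∨ n = l := by lia
  exacts [by simpa using hk, by simpa using hl]

theorem HasColour.exists_sub_and_sub_and_sub {b : Fin 2 → Fin 2 → ℝ}
    (hb : LinearIndependent ℝ b) {x y z : Fin 2 → ℝ} {k l : Fin 2} (hxy : HasColour b (x - y) k)
    (hkl : k ≠ l) (hx : x ≠ z) (hy : y ≠ z) :
    ∃ q, HasColour b (q - x) k ∧ HasColour b (q - y) k ∧ HasColour b (q - z) l := by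
  have hne : (x - y) ⬝ᵥ b k ≠ 0 := hxy.dotProduct_ne_zero
  let q : ℝ → Fin 2 → ℝ := fun t => x + t • (x - y)
  have hqx : ∀ t ≠ 0, HasColour b (q t - x) k := fun t ht => by simpa [q] using hxy.smul ht
  have hqy : ∀ t ≠ -1, HasColour b (q t - y) k := fun t ht => by
    have hline : q t - y = (t + 1) • (x - y) := by
      simp only [q]
      module
    exact hline ▸ hxy.smul fun h => ht (eq_neg_of_add_eq_zero_left h)
  -- The point of the line `xy` that has the same `k`-th coordinate as `z`.
  obtain ⟨t₀, ht₀⟩ : ∃ t, (q t - z) ⬝ᵥ b k = 0 :=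
    ⟨(z - x) ⬝ᵥ b k / ((x - y) ⬝ᵥ b k), by
      simp only [q, sub_dotProduct, add_dotProduct, smul_dotProduct, smul_eq_mul] at hne ⊢
      field_simp
      ring⟩
  by_cases hz : q t₀ = z
  · have hx₀ : t₀ ≠ 0 := by
      rintro rfl
      exact hx (by simpa [q] using hz)
    have hy₀ : t₀ ≠ -1 := by
      rintro rfl
      exact hy (by simpa [q] using hz)
    have hnear : ∀ w, HasColour b (q t₀ - w) k → ∀ᶠ q' in 𝓝 z, HasColour b (q' - w) k :=
      fun w hw => HasColour.eventually (c := (· - w)) (hz ▸ hw) (by fun_prop)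
    obtain ⟨q', hqz', hqx', hqy'⟩ := ((frequently_hasColour_sub hb z l).and_eventually
      ((hnear x (hqx t₀ hx₀)).and (hnear y (hqy t₀ hy₀)))).exists
    exact ⟨q', hqx', hqy', hqz'⟩
  · have hnear : ∀ᶠ t in 𝓝[≠] t₀, HasColour b (q t - z) l := nhdsWithin_le_nhds
      ((hasColour_of_dotProduct_eq_zero hb hkl (sub_ne_zero.2 hz) ht₀).eventually
        (c := fun t => q t - z) (by fun_prop))
    obtain ⟨t, htz, htx, hty⟩ := (hnear.and (nhdsNE_le_cofinite t₀
      ((eventually_cofinite_ne 0).and (eventually_cofinite_ne (-1))))).exists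
    exact ⟨q t, hqx t htx, hqy t hty, htz⟩

end Position

/-! ### Placements with connected colour classes -/

section Placement

open scoped Finset

variable {V : Type*} {d s : ℕ}

/-- Placements of the subgraph of `G` induced by `S` for which every pair of points of `S`, adjacent
or not, has a colour and the edges of each colour connect `S`. Colouring the nonadjacent pairs lets
a placement be extended by edges that are not yet there. -/
structure IsConnectedPlacement (b : Fin s → Fin d → ℝ) (G : SimpleGraph V) (S : Finset V)
    (p : V → Fin d → ℝ) : Prop where
  pairwise : (S : Set V).Pairwise fun x y => ∃ k, HasColour b (p x - p y) k
  preconnected : ∀ k, ((monochrome b G p k).induce (S : Set V)).Preconnected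

namespace IsConnectedPlacement

variable {b : Fin s → Fin d → ℝ} {G : SimpleGraph V} {S T : Finset V} {p : V → Fin d → ℝ}

theorem singleton (b : Fin s → Fin d → ℝ) (G : SimpleGraph V) (v : V) (p : V → Fin d → ℝ) :
    IsConnectedPlacement b G {v} p := by
  refine ⟨by simp, fun k => preconnected_induce_iff_forall_const.2 fun f _ x hx y hy => ?_⟩
  rw [Finset.mem_coe, Finset.mem_singleton] at hx hy
  rw [hx, hy]

theorem connected_monochrome [Fintype V] [Nonempty V]
    (hp : IsConnectedPlacement b G Finset.univ p) (k : Fin s) :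
    (monochrome b G p k).Connected := by
  have hconst := preconnected_induce_iff_forall_const.1 (hp.preconnected k)
  refine ⟨preconnected_iff_forall_const.2 fun f hf x y => ?_⟩
  exact hconst f (fun x _ y _ => hf x y) x (by simp) y (by simp)

variable [DecidableEq V]

/-- An edge of `G'` that is not in `G` is replaced by a path through `v`. -/
theorem update {G' : SimpleGraph V} (hp : IsConnectedPlacement b G' S p) {v : V} (hv : v ∉ S)
    {q : Fin d → ℝ} (hq : ∀ x ∈ S, ∃ k, HasColour b (q - p x) k)
    (hjoin : ∀ k, ∃ x ∈ S, G.Adj v x ∧ HasColour b (q - p x) k)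
    (hG : ∀ k, ∀ x ∈ S, ∀ y ∈ S, (monochrome b G' p k).Adj x y → G.Adj x y ∨
      (G.Adj v x ∧ HasColour b (q - p x) k) ∧ G.Adj v y ∧ HasColour b (q - p y) k) :
    IsConnectedPlacement b G (insert v S) (Function.update p v q) := by
  have hold : ∀ x ∈ S, Function.update p v q x = p x := fun x hx =>
    Function.update_of_ne (ne_of_mem_of_not_mem hx hv) q p
  have hnew : Function.update p v q v = q := Function.update_self v q p
  have hsymm : Std.Symm fun x y => ∃ k, HasColour b
      (Function.update p v q x - Function.update p v q y) k :=
    ⟨fun x y ⟨k, hk⟩ => ⟨k, (hasColour_sub_comm b _ _ k).1 hk⟩⟩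
  constructor
  · rw [Finset.coe_insert, Set.pairwise_insert_of_symm_of_notMem hv]
    refine ⟨fun x hx y hy hxy => ?_, fun x hx => ?_⟩
    · simpa only [hold x hx, hold y hy] using hp.pairwise hx hy hxy
    · simpa only [hnew, hold x hx] using hq x hx
  · refine fun k => preconnected_induce_iff_forall_const.2 fun f hf => ?_
    have hnewAdj : ∀ x ∈ S, G.Adj v x → HasColour b (q - p x) k → f v = f x :=
      fun x hx hadj hk => hf v (by simp) x (by simp [hx]) ⟨hadj, by rwa [hnew, hold x hx]⟩
    have hconst := preconnected_induce_iff_forall_const.1 (hp.preconnected k) f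
      fun x hx y hy hxy => by
        obtain hadj | ⟨⟨hvx, hkx⟩, hvy, hky⟩ := hG k x hx y hy hxy
        · exact hf x (by simp [Finset.mem_coe.1 hx]) y (by simp [Finset.mem_coe.1 hy])
            ⟨hadj, by rw [hold x hx, hold y hy]; exact hxy.2⟩
        · exact (hnewAdj x hx hvx hkx).symm.trans (hnewAdj y hy hvy hky)
    obtain ⟨z, hz, hvz, hkz⟩ := hjoin k
    have heq : ∀ x ∈ insert v S, f x = f z := fun x hx => by
      obtain rfl | hx := Finset.mem_insert.1 hx
      exacts [hnewAdj z hz hvz hkz, hconst x hx z hz]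
    exact fun x hx y hy => (heq x hx).trans (heq y hy).symm

theorem eventually_hasColour_piecewise (b : Fin s → Fin d → ℝ) (S T : Finset V)
    (p p' : V → Fin d → ℝ) (h : V) :
    ∀ᶠ ε in 𝓝 (0 : ℝ), ∀ x ∈ S, ∀ y ∈ S, ∀ k,
      HasColour b (p' (collapse T h x) - p' (collapse T h y)) k →
      HasColour b (T.piecewise (fun z => p' h + ε • p z) p' x -
        T.piecewise (fun z => p' h + ε • p z) p' y) k := by
  have hcont : ∀ x, Continuous fun ε : ℝ => T.piecewise (fun z => p' h + ε • p z) p' x :=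
    fun x => by
      by_cases hx : x ∈ T
      · simp only [Finset.piecewise_eq_of_mem _ _ _ hx]
        fun_prop
      · simp only [Finset.piecewise_eq_of_notMem _ _ _ hx]
        fun_prop
  have hzero : ∀ x, T.piecewise (fun z => p' h + (0 : ℝ) • p z) p' x = p' (collapse T h x) :=
    fun x => by
      by_cases hx : x ∈ T
      · simp [hx, collapse_of_mem hx]
      · simp [hx, collapse_of_notMem hx]
  simp only [Filter.eventually_all_finset, Filter.eventually_all]
  intro x _ y _ k hk
  rw [← hzero, ← hzero] at hk
  exact hk.eventually (c := fun ε : ℝ => T.piecewise (fun z => p' h + ε • p z) p' x -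
    T.piecewise (fun z => p' h + ε • p z) p' y) ((hcont x).sub (hcont y)).continuousAt

theorem exists_piecewise (hT : IsConnectedPlacement b G T p) (hTS : T ⊆ S) {h : V} (hh : h ∈ T)
    {p' : V → Fin d → ℝ}
    (hp' : IsConnectedPlacement b (G.map (collapse T h)) (insert h (S \ T)) p') :
    ∃ ε : ℝ, IsConnectedPlacement b G S (T.piecewise (fun x => p' h + ε • p x) p') := by
  obtain ⟨ε, hε, hε₀⟩ := (((eventually_hasColour_piecewise b S T p p' h).filter_mono
    (nhdsWithin_le_nhds (s := {0}ᶜ))).and self_mem_nhdsWithin).exists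
  have hmem : ∀ {x}, collapse T h x ∈ insert h (S \ T) ↔ x ∈ S := fun {x} => by
    grind [collapse]
  have hscale : ∀ x ∈ T, ∀ y ∈ T, ∀ k, HasColour b (p x - p y) k →
      HasColour b (T.piecewise (fun z => p' h + ε • p z) p' x -
        T.piecewise (fun z => p' h + ε • p z) p' y) k := fun x hx y hy k hk => by
    simpa [hx, hy, ← smul_sub] using hk.smul hε₀
  refine ⟨ε, fun x hx y hy hxy => ?_, fun k => ?_⟩
  · by_cases hcol : collapse T h x = collapse T h y
    · have hxyT : x ∈ T ∧ y ∈ T := by grind [collapse]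
      obtain ⟨k, hk⟩ := hT.pairwise hxyT.1 hxyT.2 hxy
      exact ⟨k, hscale x hxyT.1 y hxyT.2 k hk⟩
    · obtain ⟨k, hk⟩ := hp'.pairwise (hmem.2 hx) (hmem.2 hy) hcol
      exact ⟨k, hε x hx y hy k hk⟩
  · refine preconnected_induce_iff_forall_const.2 fun f hf => ?_
    have hconstT := preconnected_induce_iff_forall_const.1 (hT.preconnected k) f
      fun x hx y hy hxy => hf x (hTS hx) y (hTS hy) ⟨hxy.1, hscale x hx y hy k hxy.2⟩
    have hcollapse : ∀ x, f (collapse T h x) = f x := fun x => by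
      by_cases hx : x ∈ T
      · rw [collapse_of_mem hx, hconstT h hh x hx]
      · rw [collapse_of_notMem hx]
    have hconst := preconnected_induce_iff_forall_const.1 (hp'.preconnected k) f <| by
      rintro _ hx _ hy ⟨⟨-, x, y, hadj, rfl, rfl⟩, hk⟩
      rw [Finset.mem_coe, hmem] at hx hy
      rw [hcollapse, hcollapse]
      exact hf x hx y hy ⟨hadj, hε x hx y hy k hk⟩
    intro x hx y hy
    rw [← hcollapse x, ← hcollapse y]
    exact hconst _ (hmem.2 hx) _ (hmem.2 hy)

end IsConnectedPlacement

end Placement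

/-! ### Tight graphs have connected placements -/

section Construction

open scoped Finset

variable {V : Type*} {b : Fin 2 → Fin 2 → ℝ} {G : SimpleGraph V}
  {S T : Finset V} {p : V → Fin 2 → ℝ} {v x y z : V}

theorem IsConnectedPlacement.exists_insert [DecidableEq V] (hb : LinearIndependent ℝ b)
    (hp : IsConnectedPlacement b G S p) (hv : v ∉ S) (h2 : 2 ≤ #(neighborsIn G S v)) :
    ∃ p', IsConnectedPlacement b G (insert v S) p' := by
  obtain ⟨x, hxN, y, hyN, hxy⟩ := Finset.one_lt_card.1 h2
  obtain ⟨hx, hvx⟩ := mem_neighborsIn.1 hxN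
  obtain ⟨hy, hvy⟩ := mem_neighborsIn.1 hyN
  obtain ⟨l, hl⟩ := hp.pairwise hx hy hxy
  obtain ⟨k, hkl⟩ := exists_ne l
  obtain ⟨q, ⟨hqx, hqy⟩, hq⟩ := exists_mem_forall_hasColour_sub hb S p
    ((isOpen_setOf_hasColour_sub b (p x) k).inter (isOpen_setOf_hasColour_sub b (p y) l))
    (hl.exists_sub_and_sub hb k)
  refine ⟨_, hp.update hv hq (fun m => ?_) fun _ _ _ _ _ h => .inl h.1⟩
  obtain rfl | rfl : m = k ∨ m = l := by lia
  exacts [⟨x, hx, hvx, hqx⟩, ⟨y, hy, hvy, hqy⟩]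

theorem IsConnectedPlacement.exists_insert_of_sup_edge [DecidableEq V]
    (hb : LinearIndependent ℝ b) (hp : IsConnectedPlacement b (G ⊔ SimpleGraph.edge x y) S p)
    (hv : v ∉ S) (hx : x ∈ S) (hy : y ∈ S) (hz : z ∈ S) (hxy : x ≠ y)
    (hxz : x ≠ z) (hyz : y ≠ z) (hvx : G.Adj v x) (hvy : G.Adj v y) (hvz : G.Adj v z) :
    ∃ p', IsConnectedPlacement b G (insert v S) p' := by
  obtain ⟨k, hk⟩ := hp.pairwise hx hy hxy
  obtain ⟨l, hlk⟩ := exists_ne k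
  have hne : ∀ w ∈ S, w ≠ z → p w ≠ p z := fun w hw hwz =>
    (hp.pairwise hw hz hwz).elim fun _ h => h.ne
  obtain ⟨q, ⟨hqx, hqy, hqz⟩, hq⟩ := exists_mem_forall_hasColour_sub hb S p
    ((isOpen_setOf_hasColour_sub b (p x) k).inter
      ((isOpen_setOf_hasColour_sub b (p y) k).inter (isOpen_setOf_hasColour_sub b (p z) l)))
    (hk.exists_sub_and_sub_and_sub hb hlk.symm (hne x hx hxz) (hne y hy hyz))
  refine ⟨_, hp.update hv hq (fun m => ?_) fun m x' _ y' _ h => ?_⟩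
  · obtain rfl | rfl : m = k ∨ m = l := by lia
    exacts [⟨x, hx, hvx, hqx⟩, ⟨z, hz, hvz, hqz⟩]
  · obtain ⟨hadj | hedge, hm⟩ := h
    · exact .inl hadj
    · obtain ⟨⟨rfl, rfl⟩ | ⟨rfl, rfl⟩, -⟩ := (SimpleGraph.edge_adj _ _ _ _).1 hedge
      · obtain rfl := hk.unique hm
        exact .inr ⟨⟨hvx, hqx⟩, hvy, hqy⟩
      · obtain rfl := hk.unique ((hasColour_sub_comm b _ _ _).1 hm)
        exact .inr ⟨⟨hvy, hqy⟩, hvx, hqx⟩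

/-- The complete graph on `Fin 4` is the union of the path `0123` and its complement `2031`. -/
theorem exists_forall_hasColour_sub_fin_four (hb : LinearIndependent ℝ b) :
    ∃ q : Fin 4 → Fin 2 → ℝ, ∀ i j, i ≠ j →
      HasColour b (q i - q j) (if (i : ℕ) + 1 = j ∨ (j : ℕ) + 1 = i then 0 else 1) := by
  let c : Fin 4 → Fin 2 → ℤ := ![![3, -1], ![0, 0], ![4, 2], ![1, 3]]
  choose q hq using fun i => exists_dotProduct_eq hb fun k => (c i k : ℝ)
  refine ⟨q, fun i j hij => hasColour_iff.2 fun l hl => ?_⟩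
  simp only [sub_dotProduct, hq]
  norm_cast
  revert i j l
  decide

theorem exists_isConnectedPlacement_of_isNClique (hb : LinearIndependent ℝ b)
    (hS : G.IsNClique 4 S) : ∃ p, IsConnectedPlacement b G S p := by
  classical
  obtain ⟨q, hq⟩ := exists_forall_hasColour_sub_fin_four hb
  let e := S.equivFinOfCardEq hS.card_eq
  have hinj : Function.Injective fun i => (e.symm i : V) :=
    Subtype.val_injective.comp e.symm.injective
  have hp : ∀ i, Function.extend (fun i => (e.symm i : V)) q 0 (e.symm i) = q i :=
    hinj.extend_apply q 0
  have hsurj : ∀ x ∈ S, ∃ i, (e.symm i : V) = x := fun x hx => ⟨e ⟨x, hx⟩, by simp⟩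
  refine ⟨Function.extend (fun i => (e.symm i : V)) q 0, fun x hx y hy hxy => ?_, fun k => ?_⟩
  · obtain ⟨i, rfl⟩ := hsurj x hx
    obtain ⟨j, rfl⟩ := hsurj y hy
    rw [hp, hp]
    exact ⟨_, hq i j (by grind)⟩
  · refine preconnected_induce_iff_forall_const.2 fun f hf => ?_
    have hadj : ∀ i j : Fin 4, i ≠ j →
        (if (i : ℕ) + 1 = j ∨ (j : ℕ) + 1 = i then 0 else 1) = k →
        f (e.symm i) = f (e.symm j) := fun i j hij hk =>
      hf _ (e.symm i).2 _ (e.symm j).2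
        ⟨hS.isClique (e.symm i).2 (e.symm j).2 (hinj.ne hij), by
          rw [hp, hp, ← hk]
          exact hq i j hij⟩
    have hconst : ∀ i, f (e.symm 0) = f (e.symm i) := by
      obtain rfl | rfl : k = 0 ∨ k = 1 := by lia
      · have h01 := hadj 0 1 (by decide) rfl
        have h02 := h01.trans (hadj 1 2 (by decide) rfl)
        have h03 := h02.trans (hadj 2 3 (by decide) rfl)
        exact fun i => by fin_cases i <;> first | rfl | assumption
      · have h02 := hadj 0 2 (by decide) rfl
        have h03 := hadj 0 3 (by decide) rfl
        have h01 := h03.trans (hadj 3 1 (by decide) rfl)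
        exact fun i => by fin_cases i <;> first | rfl | assumption
    intro x hx y hy
    obtain ⟨i, rfl⟩ := hsurj x hx
    obtain ⟨j, rfl⟩ := hsurj y hy
    rw [← hconst i, ← hconst j]

theorem exists_isConnectedPlacement_of_card_neighborsIn_le_one (hS : IsSparseOn G S)
    (hSt : IsTightOn G S) (hTS : T ⊆ S) (h2 : 2 ≤ #T) (hT : IsTightOn G T)
    (hdeg : ∀ v ∈ S, v ∉ T → #(neighborsIn G T v) ≤ 1) (hp : IsConnectedPlacement b G T p)
    (ih : ∀ (G' : SimpleGraph V) (S' : Finset V), #S' < #S → IsSparseOn G' S' →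
      IsTightOn G' S' → ∃ p, IsConnectedPlacement b G' S' p) :
    ∃ p, IsConnectedPlacement b G S p := by
  classical
  obtain ⟨h, hh⟩ : T.Nonempty := Finset.card_pos.1 (by lia)
  have hlt : #(insert h (S \ T)) < #S := by
    have hverts := Finset.card_sdiff_add_card_eq_card hTS
    rw [Finset.card_insert_of_notMem (by simp [hh])]
    lia
  replace hdeg : ∀ v ∈ S \ T, #(neighborsIn G T v) ≤ 1 := fun v hv =>
    hdeg v (Finset.mem_sdiff.1 hv).1 (Finset.mem_sdiff.1 hv).2
  obtain ⟨p', hp'⟩ := ih _ _ hlt (hS.map_collapse hT hTS hh hdeg)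
    (hSt.map_collapse hT hTS hh hdeg)
  obtain ⟨ε, hε⟩ := hp.exists_piecewise hTS hh hp'
  exact ⟨_, hε⟩

theorem exists_isConnectedPlacement_of_isTightOn_ssubset (hb : LinearIndependent ℝ b)
    (hS : IsSparseOn G S) (hSt : IsTightOn G S) (hTS : T ⊂ S) (h2 : 2 ≤ #T) (hT : IsTightOn G T)
    (ih : ∀ (G' : SimpleGraph V) (S' : Finset V), #S' < #S → IsSparseOn G' S' →
      IsTightOn G' S' → ∃ p, IsConnectedPlacement b G' S' p) :
    ∃ p, IsConnectedPlacement b G S p := by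
  classical
  obtain ⟨M, hTM, hM⟩ := Finset.exists_le_maximal {X ∈ S.ssubsets | IsTightOn G X}
    (by simpa using ⟨hTS, hT⟩)
  obtain ⟨hMS, hMt⟩ : M ⊂ S ∧ IsTightOn G M := by simpa using hM.1
  obtain ⟨p, hp⟩ := ih G M (Finset.card_lt_card hMS) (hS.mono hMS.subset) hMt
  by_cases! hdeg : ∀ v ∈ S, v ∉ M → #(neighborsIn G M v) ≤ 1
  · exact exists_isConnectedPlacement_of_card_neighborsIn_le_one hS hSt hMS.subset
      (h2.trans (Finset.card_le_card hTM)) hMt hdeg hp ih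
  · obtain ⟨v, hvS, hvM, htwo⟩ := hdeg
    have hinsert : IsTightOn G (insert v M) := hMt.insert_of_card_neighborsIn hvM
      ((hS.card_neighborsIn_le_two hMS.subset hMt hvS hvM).antisymm htwo)
    obtain heq | hlt := (Finset.insert_subset hvS hMS.subset).eq_or_ssubset
    · exact heq ▸ hp.exists_insert hb hvM htwo
    · have hle : insert v M ≤ M :=
        hM.2 (by simpa using ⟨hlt, hinsert⟩) (Finset.subset_insert v M)
      exact absurd (hle (Finset.mem_insert_self v M)) hvM

theorem exists_isConnectedPlacement_of_card_neighborsIn_eq_three [DecidableEq V]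
    (hb : LinearIndependent ℝ b) (hS : IsSparseOn G S) (hSt : IsTightOn G S)
    (hmin : ∀ T ⊂ S, 2 ≤ #T → ¬ IsTightOn G T)
    (hv : v ∈ S) (h3 : #(neighborsIn G (S.erase v) v) = 3)
    (ih : ∀ (G' : SimpleGraph V) (S' : Finset V), #S' < #S → IsSparseOn G' S' →
      IsTightOn G' S' → ∃ p, IsConnectedPlacement b G' S' p) :
    ∃ p, IsConnectedPlacement b G S p := by
  have hvS := Finset.erase_ssubset hv
  by_cases hclique : G.IsClique (neighborsIn G (S.erase v) v)
  · have hfour : G.IsNClique 4 (insert v (neighborsIn G (S.erase v) v)) :=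
      SimpleGraph.IsNClique.insert ⟨hclique, h3⟩ fun x hx => (mem_neighborsIn.1 hx).2
    have hsub : insert v (neighborsIn G (S.erase v) v) ⊆ S :=
      Finset.insert_subset hv (neighborsIn_subset.trans hvS.subset)
    obtain heq | hlt := hsub.eq_or_ssubset
    · exact exists_isConnectedPlacement_of_isNClique hb (heq ▸ hfour)
    · exact absurd (isTightOn_of_isNClique hfour) (hmin _ hlt (by simp [hfour.card_eq]))
  · simp only [SimpleGraph.isClique_iff, Set.Pairwise, not_forall, Finset.mem_coe] at hclique
    obtain ⟨x, hx, y, hy, hxy, hadj⟩ := hclique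
    obtain ⟨z, hz, hzxy⟩ : ∃ z ∈ neighborsIn G (S.erase v) v, z ∉ ({x, y} : Finset V) :=
      Finset.exists_mem_notMem_of_card_lt_card (by rw [h3, Finset.card_pair hxy]; lia)
    simp only [Finset.mem_insert, Finset.mem_singleton, not_or] at hzxy
    rw [mem_neighborsIn] at hx hy hz
    obtain ⟨p, hp⟩ := ih (G ⊔ SimpleGraph.edge x y) (S.erase v) (Finset.card_lt_card hvS)
      ((hS.mono hvS.subset).sup_edge hxy fun T hT => hmin T (hT.trans_ssubset hvS))
      (hSt.erase_sup_edge hv h3 hx.1 hy.1 hxy hadj)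
    have hext := hp.exists_insert_of_sup_edge hb (Finset.notMem_erase v S) hx.1 hy.1 hz.1 hxy
      (Ne.symm hzxy.1) (Ne.symm hzxy.2) hx.2 hy.2 hz.2
    rwa [Finset.insert_erase hv] at hext

theorem IsSparseOn.exists_isConnectedPlacement (hb : LinearIndependent ℝ b)
    (hS : IsSparseOn G S) (hSt : IsTightOn G S) : ∃ p, IsConnectedPlacement b G S p := by
  classical
  induction hn : #S using Nat.strong_induction_on generalizing G S with
  | _ n ih =>
  subst hn
  replace ih : ∀ (G' : SimpleGraph V) (S' : Finset V), #S' < #S → IsSparseOn G' S' →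
      IsTightOn G' S' → ∃ p, IsConnectedPlacement b G' S' p :=
    fun G' S' hlt hS' hSt' => ih _ hlt hS' hSt' rfl
  by_cases hcard : 2 ≤ #S
  · by_cases hmin : ∀ T ⊂ S, 2 ≤ #T → ¬ IsTightOn G T
    · obtain ⟨v, hv, h3⟩ := hS.exists_card_neighborsIn_eq_three hSt hcard hmin
      exact exists_isConnectedPlacement_of_card_neighborsIn_eq_three hb hS hSt hmin hv h3 ih
    · push Not at hmin
      obtain ⟨T, hTS, h2, hT⟩ := hmin
      exact exists_isConnectedPlacement_of_isTightOn_ssubset hb hS hSt hTS h2 hT ih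
  · obtain ⟨v, rfl⟩ : ∃ v, S = {v} := Finset.card_eq_one.1 (by rw [IsTightOn] at hSt; lia)
    exact ⟨0, .singleton b G v 0⟩

end Construction

end PolytopicRigidity

open PolytopicRigidity in
theorem theorem4p10 {V : Type*} [Fintype V] [Nonempty V]
    (b : Fin 2 → Fin 2 → ℝ) (hb : LinearIndependent ℝ b)
    (G : SimpleGraph V) (p : V → Fin 2 → ℝ)
    (hwp : IsWellPositioned b G p) (hreg : IsRegular b G p) :
    List.TFAE
      [IsMinimallyInfinitesimallyRigid (polyNorm b) G p,
       (monochrome b G p 0).IsTree ∧ (monochrome b G p 1).IsTree ∧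
         Disjoint (monochrome b G p 0).edgeSet (monochrome b G p 1).edgeSet,
       IsTwoTwoTight G] := by
  have htrees : ((monochrome b G p 0).IsTree ∧ (monochrome b G p 1).IsTree ∧
      Disjoint (monochrome b G p 0).edgeSet (monochrome b G p 1).edgeSet) ↔
      ∀ k, (monochrome b G p k).IsTree := by
    simp only [Fin.forall_fin_two, disjoint_edgeSet_monochrome b G p zero_ne_one, and_true]
  rw [htrees]
  tfae_have 1 ↔ 2 := isMinimallyInfinitesimallyRigid_iff hb hwp
  tfae_have 2 → 3 := isTwoTwoTight_of_isTree hwp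
  tfae_have 3 → 2 := fun hG => by
    obtain ⟨p', hp'⟩ := hG.1.isSparseOn.exists_isConnectedPlacement hb hG.isTightOn
    have hconn := hreg.connected_monochrome hb hp'.connected_monochrome
    have hcard : G.edgeSet.ncard + 2 = 2 * Nat.card V := by
      have hcount := hG.2
      lia
    exact isTree_monochrome_of_connected hwp hconn hcard
  tfae_finish
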